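/- Let $p\neq q$ be prime numbers, and let $\Delta=\mathrm{conv}(v_0,\dots,v_d)\subset\mathbb R^d$ be a $d$-dimensional simplex with vertices $v_0,\dots,v_d\in\mathbb Z^d$. For a set $P\subset\mathbb R^d$ let $\mathrm{Vol}(P)$ denote its normalized volume ($d!$ times its Euclidean volume) and let $P^\vee=\{y\in\mathbb R^d:\langle x,y\rangle\le 1\text{ for all }x\in P\}$ be its dual. A lattice polytope $P\subset\mathbb R^d$ is reflexive if the origin is its only interior lattice point and $P^\vee$ is a lattice polytope; it is Gorenstein of index $r$ (an integer $r\ge1$) if $rP+w$ is reflexive for some $w\in\mathbb Z^d$. Put $$\Lambda_\Delta=\Big\{(\lambda_0,\dots,\lambda_d)\in(\mathbb R/\mathbb Z)^{d+1}:\ \sum_{i=0}^d\lambda_i(v_i,1)\in\mathbb Z^{d+1}\Big\}.$$ Suppose that $\mathrm{Vol}(\Delta)=pq$, that $\Delta$ is Gorenstein of index $r$, and that $\Delta$ is not a lattice pyramid, i.e. it is not the image of $\mathrm{conv}(\Delta'\times\{0\},(0,\dots,0,1))$, for any $(d-1)$-dimensional lattice simplex $\Delta'\subset\mathbb R^{d-1}$,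 under a map $x\mapsto xU+w$ with $U\in\mathbb Z^{d\times d}$, $\det U=\pm1$, $w\in\mathbb Z^d$. Let $t$ be the unique interior lattice point of $r\Delta$. Then there exist nonnegative integers $s_1,s_2,s_3$ such that 1. $s_1+s_2+s_3=d+1$ and $rpq=s_1q+s_2p+s_3$; 2. for some ordering of the vertices of $\Delta$, the group $\Lambda_\Delta$ is generated by $$\Big(\underbrace{\tfrac1p,\dots,\tfrac1p}_{s_1},\underbrace{\tfrac1q,\dots,\tfrac1q}_{s_2},\underbrace{\tfrac1{pq},\dots,\tfrac1{pq}}_{s_3}\Big);$$ and for all nonnegative integers $s_1,s_2,s_3$ that satisfy (1) and (2), $$\mathrm{Vol}\big((r\Delta-t)^\vee\big)=r\,p^{\,s_1+s_3-1}\,q^{\,s_2+s_3-1}.$$ -/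

import Mathlib

open scoped Pointwise

noncomputable section

namespace GorensteinSimplex

/-- The point of `ℝ^d` with the integer coordinates `z`. -/
def latticePt {d : ℕ} (z : Fin d → ℤ) : EuclideanSpace ℝ (Fin d) :=
  WithLp.toLp 2 (fun j => (z j : ℝ))

/-- The lattice `ℤ^d` inside `ℝ^d`. -/
def latticePoints (d : ℕ) : Set (EuclideanSpace ℝ (Fin d)) :=
  Set.range (latticePt (d := d))

/-- A lattice polytope: the convex hull of a finite set of lattice points. -/
def IsLatticePolytope {d : ℕ} (P : Set (EuclideanSpace ℝ (Fin d))) : Prop :=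
  ∃ S : Finset (Fin d → ℤ), P = convexHull ℝ (latticePt '' (S : Set (Fin d → ℤ)))

/-- The dual `P^∨ = {y : ⟨x, y⟩ ≤ 1 for all x ∈ P}`. -/
def polarDual {d : ℕ} (P : Set (EuclideanSpace ℝ (Fin d))) : Set (EuclideanSpace ℝ (Fin d)) :=
  {y | ∀ x ∈ P, inner ℝ x y ≤ 1}

/-- The normalized volume: `d!` times the Euclidean volume. -/
def normalizedVolume {d : ℕ} (P : Set (EuclideanSpace ℝ (Fin d))) : ℝ :=
  (d.factorial : ℝ) * (MeasureTheory.volume P).toReal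

/-- A lattice polytope whose only interior lattice point is the origin and whose dual
is again a lattice polytope. -/
def IsReflexive {d : ℕ} (P : Set (EuclideanSpace ℝ (Fin d))) : Prop :=
  IsLatticePolytope P ∧ interior P ∩ latticePoints d = {0} ∧ IsLatticePolytope (polarDual P)

/-- `P` is Gorenstein of index `r`: some lattice translate of `rP` is reflexive. -/
def IsGorenstein {d : ℕ} (r : ℕ) (P : Set (EuclideanSpace ℝ (Fin d))) : Prop :=
  0 < r ∧ IsLatticePolytope P ∧
    ∃ (Q : Set (EuclideanSpace ℝ (Fin d))) (w : Fin d → ℤ),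
      IsReflexive Q ∧ Q = (fun x => x + latticePt w) '' ((r : ℝ) • P)

/-- `Q = f_U(P) + w` for a unimodular `U` acting on row vectors and an integral vector `w`. -/
def UnimodularlyEquivalent {d : ℕ} (P Q : Set (EuclideanSpace ℝ (Fin d))) : Prop :=
  ∃ (U : Matrix (Fin d) (Fin d) ℤ) (w : Fin d → ℤ), (U.det = 1 ∨ U.det = -1) ∧
    Q = (fun x : EuclideanSpace ℝ (Fin d) =>
      WithLp.toLp 2 (Matrix.vecMul x.ofLp (U.map (fun a : ℤ => (a : ℝ)))) + latticePt w) '' P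

/-- The integral points `v 0, …, v d` are the vertices of a `d`-dimensional simplex. -/
def IsLatticeSimplex {d : ℕ} (v : Fin (d + 1) → Fin d → ℤ) : Prop :=
  AffineIndependent ℝ (fun i => latticePt (v i))

/-- The convex hull of the points `v 0, …, v d`. -/
def simplex {d : ℕ} (v : Fin (d + 1) → Fin d → ℤ) : Set (EuclideanSpace ℝ (Fin d)) :=
  convexHull ℝ (Set.range (fun i => latticePt (v i)))

/-- `Pyr(P) = conv (P × {0}, (0, …, 0, 1))`. -/
def pyramid {n : ℕ} (P : Set (EuclideanSpace ℝ (Fin n))) :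
    Set (EuclideanSpace ℝ (Fin (n + 1))) :=
  convexHull ℝ
    (insert (EuclideanSpace.single (Fin.last n) (1 : ℝ))
      ((fun x : EuclideanSpace ℝ (Fin n) =>
        (WithLp.toLp 2 (Fin.snoc (α := fun _ => ℝ) x.ofLp 0) :
          EuclideanSpace ℝ (Fin (n + 1)))) '' P))

/-- `P` is, up to unimodular equivalence, the lattice pyramid over a lattice simplex of one
dimension less (a point is not a pyramid). -/
def IsLatticePyramid : {d : ℕ} → Set (EuclideanSpace ℝ (Fin d)) → Prop
  | 0, _ => False
  | n + 1, P => ∃ u : Fin (n + 1) → Fin n → ℤ, IsLatticeSimplex u ∧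
      UnimodularlyEquivalent (pyramid (simplex u)) P

/-- The group `Λ_Δ ⊆ (ℝ/ℤ)^{d+1}` of all `λ` with `∑ λ_i (v_i, 1) ∈ ℤ^{d+1}`; as the `v_i` are
integral, this says that `∑ λ_i (v_i, 1)` vanishes in `(ℝ/ℤ)^{d+1}`. -/
def Lam {d : ℕ} (v : Fin (d + 1) → Fin d → ℤ) : AddSubgroup (Fin (d + 1) → UnitAddCircle) where
  carrier := {l | (∀ j, ∑ i, v i j • l i = 0) ∧ ∑ i, l i = 0}
  zero_mem' := by simp
  add_mem' := by
    rintro a b ⟨ha, ha'⟩ ⟨hb, hb'⟩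
    refine ⟨fun j => ?_, ?_⟩
    · simp [smul_add, Finset.sum_add_distrib, ha j, hb j]
    · simp [Finset.sum_add_distrib, ha', hb']
  neg_mem' := by
    rintro a ⟨ha, ha'⟩
    refine ⟨fun j => ?_, ?_⟩
    · simp [ha j]
    · simp [ha']

/-- The class in `(ℝ/ℤ)^{d+1}` of the vector `(1/p, …, 1/p, 1/q, …, 1/q, 1/(pq), …, 1/(pq))` with
`s₁` entries `1/p`, then `s₂` entries `1/q`, and all remaining entries `1/(pq)`. -/
def weightVec (d p q s₁ s₂ : ℕ) : Fin (d + 1) → UnitAddCircle := fun i =>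
  if i.val < s₁ then ((1 / (p : ℝ) : ℝ) : UnitAddCircle)
  else if i.val < s₁ + s₂ then ((1 / (q : ℝ) : ℝ) : UnitAddCircle)
  else ((1 / ((p : ℝ) * q) : ℝ) : UnitAddCircle)

/-- `s₁ + s₂ + s₃ = d + 1`, `rpq = s₁q + s₂p + s₃`, and, for some ordering of the vertices, `Λ_Δ` is
generated by the vector with `s₁` entries `1/p`, `s₂` entries `1/q` and `s₃` entries `1/(pq)`. -/
def HasType {d : ℕ} (p q r : ℕ) (v : Fin (d + 1) → Fin d → ℤ) (s₁ s₂ s₃ : ℕ) : Prop :=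
  s₁ + s₂ + s₃ = d + 1 ∧ r * p * q = s₁ * q + s₂ * p + s₃ ∧
    ∃ σ : Equiv.Perm (Fin (d + 1)),
      Lam (v ∘ σ) = AddSubgroup.zmultiples (weightVec d p q s₁ s₂)

end GorensteinSimplex

end

/-!
Let `M` be the matrix with rows `(1, v_i)`, so that `|det M| = Vol(Δ) = pq` and `Λ_Δ`, the kernel of
`M` on the torus, is dual to the cokernel of `M` and has order `pq` (`normalizedVolume_simplex`,
`natCard_torusKernel`).

Write `(r, t) = ∑ b_i (1, v_i)`. The `b_i` are positive because `t` is interior, and the dual of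
`rΔ - t` is the simplex with vertices `y_i = -a_i / b_i`, where `a_i` is the linear part of the `i`-th
barycentric coordinate (`polarDual_eq_convexHull`). Since `Δ` is Gorenstein these vertices are
integral, which forces the `i`-th coordinate of *every* lattice point of `ℤ^{d+1}` with respect to
the `(1, v_k)` to be an integral multiple of `b_i` (`coord_eq_mul_of_pairing`). Applied to `(1, v_i)`
itself this gives `b_i = 1 / m_i` with `m_i` a positive integer, and `m_i` kills the `i`-th
coordinate of `Λ_Δ`. If `m_i = 1`, then `-y_i` is an integral functional of lattice height one over
the facet opposite to `v_i`, and `Δ` is a lattice pyramid (`isLatticePyramid_of_functional`); so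
all `m_i > 1` (`exists_weights`).

The vector `(1 / m_i)_i` lies in `Λ_Δ`, a group of order `pq` which is killed coordinatewise by the
`m_i`. Cauchy's theorem shows that `p` and `q` both divide its order, so it generates `Λ_Δ`
and each `m_i` is one of `p`, `q`, `pq` (`eq_zmultiples_of_forall_nsmul`). The numbers of vertices with
these three values are `s₁, s₂, s₃`, and `∑ b_i = r` is the numerical condition.

Finally a determinant computation gives `Vol((rΔ - t)^∨) = r ∏ m_i / (pq)`
(`abs_det_homMatrix_dualVertex`). Any generator of `Λ_Δ` has entries of the same additive orders, so
the multiset of the `m_i`, hence the volume, can be read off from any admissible `s₁, s₂, s₃`.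
-/

open scoped Pointwise
open MeasureTheory Matrix

namespace GorensteinSimplex

/-! ### The normalized volume of a simplex as a determinant -/

/-- The corner simplex `{x ≥ 0, ∑ x_i ≤ c}` in `ℝ^n`. -/
def cornerSimplex (n : ℕ) (c : ℝ) : Set (Fin n → ℝ) :=
  {x | (∀ i, 0 ≤ x i) ∧ ∑ i, x i ≤ c}

lemma isClosed_cornerSimplex (n : ℕ) (c : ℝ) : IsClosed (cornerSimplex n c) := by
  have : cornerSimplex n c = (⋂ i, {x | 0 ≤ x i}) ∩ {x | ∑ i, x i ≤ c} := by
    ext; simp [cornerSimplex]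
  rw [this]
  refine (isClosed_iInter fun i => isClosed_le continuous_const (continuous_apply i)).inter
    (isClosed_le (by fun_prop) continuous_const)

lemma integral_sub_pow_div_factorial (n : ℕ) (c : ℝ) :
    ∫ s in (0 : ℝ)..c, (c - s) ^ n / (n.factorial : ℝ) = c ^ (n + 1) / ((n + 1).factorial : ℝ) := by
  rw [intervalIntegral.integral_div,
    intervalIntegral.integral_comp_sub_left (fun s => s ^ n) c, integral_pow]
  simp only [sub_self, sub_zero, Nat.factorial_succ, Nat.cast_mul, Nat.cast_succ]
  have := Nat.cast_ne_zero (R := ℝ).2 n.factorial_ne_zero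
  field_simp
  ring

lemma volume_cornerSimplex (n : ℕ) {c : ℝ} (hc : 0 ≤ c) :
    volume (cornerSimplex n c) = ENNReal.ofReal (c ^ n / (n.factorial : ℝ)) := by
  induction n generalizing c with
  | zero =>
    have : cornerSimplex 0 c = Set.univ := by ext; simp [cornerSimplex, hc]
    rw [this, volume_pi, Measure.pi_univ]; simp
  | succ n ih =>
    have hmp := volume_preserving_piFinSuccAbove (fun _ : Fin (n + 1) => ℝ) 0
    have hmeas := (isClosed_cornerSimplex (n + 1) c).measurableSet
    rw [← hmp.symm.measure_preimage hmeas.nullMeasurableSet, Measure.volume_eq_prod,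
      Measure.prod_apply (hmp.symm.measurable hmeas)]
    -- The slice `s = 0` is split off so that the rest is an interval integral over `(0, c]`.
    have hslice : ∀ s : ℝ, volume (Prod.mk s ⁻¹'
        ((MeasurableEquiv.piFinSuccAbove (fun _ : Fin (n + 1) => ℝ) 0).symm ⁻¹'
          cornerSimplex (n + 1) c)) =
        (Set.Ioc 0 c).indicator
          (fun s => ENNReal.ofReal ((c - s) ^ n / (n.factorial : ℝ))) s +
        ({0} : Set ℝ).indicator (fun _ => ENNReal.ofReal (c ^ n / (n.factorial : ℝ))) s := by
      intro s
      have hset : Prod.mk s ⁻¹'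
        ((MeasurableEquiv.piFinSuccAbove (fun _ : Fin (n + 1) => ℝ) 0).symm ⁻¹'
          cornerSimplex (n + 1) c) = {x | 0 ≤ s ∧ x ∈ cornerSimplex n (c - s)} := by
        ext x
        simp only [cornerSimplex, MeasurableEquiv.piFinSuccAbove, Set.mem_preimage,
          MeasurableEquiv.symm_mk, MeasurableEquiv.coe_mk, Set.mem_ofPred_eq, Fin.forall_fin_succ,
          Fin.sum_univ_succ, Fin.insertNthEquiv, Fin.insertNth_zero']
        simp [and_assoc, le_sub_iff_add_le']
      rw [hset]
      rcases lt_trichotomy s 0 with hs | rfl | hs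
      · simp [hs.not_ge, hs.ne, hs.not_gt]
      · simp [ih hc]
      · by_cases hsc : s ≤ c
        · simp [hs.le, hs, hs.ne', hsc, ih (sub_nonneg.2 hsc)]
        · have : cornerSimplex n (c - s) = ∅ := by
            ext x
            simp only [cornerSimplex, Set.mem_ofPred_eq, Set.mem_empty_iff_false, iff_false,
              not_and, not_le]
            intro hx
            have := Finset.sum_nonneg fun i (_ : i ∈ Finset.univ) => hx i
            linarith [not_le.1 hsc]
          simp [this, hsc, hs.ne']
    simp_rw [hslice]
    rw [lintegral_add_right _ (measurable_const.indicator (measurableSet_singleton 0)),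
      lintegral_indicator measurableSet_Ioc, lintegral_indicator (measurableSet_singleton 0)]
    simp only [Measure.restrict_singleton, Real.volume_singleton, zero_smul,
      lintegral_zero_measure, add_zero]
    rw [← integral_sub_pow_div_factorial, intervalIntegral.integral_of_le hc,
      ofReal_integral_eq_lintegral_ofReal]
    · exact (Continuous.integrableOn_Ioc (by fun_prop))
    · filter_upwards [ae_restrict_mem measurableSet_Ioc] with s hs
      have := sub_nonneg.2 hs.2
      positivity

/-- The matrix with rows `(1, w_i)`. -/
def homMatrix {R : Type*} [One R] {d : ℕ} (w : Fin (d + 1) → Fin d → R) :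
    Matrix (Fin (d + 1)) (Fin (d + 1)) R :=
  Matrix.of fun i => Fin.cons 1 (w i)

@[simp] lemma homMatrix_zero {R : Type*} [One R] {d : ℕ} (w : Fin (d + 1) → Fin d → R)
    (i : Fin (d + 1)) : homMatrix w i 0 = 1 := rfl

@[simp] lemma homMatrix_succ {R : Type*} [One R] {d : ℕ} (w : Fin (d + 1) → Fin d → R)
    (i : Fin (d + 1)) (j : Fin d) : homMatrix w i j.succ = w i j := rfl

lemma det_homMatrix {R : Type*} [CommRing R] {d : ℕ} (w : Fin (d + 1) → Fin d → R) :
    (homMatrix w).det = (Matrix.of fun i : Fin d => w i.succ - w 0).det := by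
  have h := Matrix.det_eq_of_forall_row_eq_smul_add_const (A := homMatrix w)
    (B := Matrix.of (Fin.cons (Fin.cons 1 (w 0)) fun i => Fin.cons 0 (w i.succ - w 0)))
    (Fin.cons 0 fun _ => 1) 0 rfl (by
      intro i j
      refine Fin.cases ?_ (fun i => ?_) i <;> refine Fin.cases ?_ (fun j => ?_) j <;> simp)
  rw [h, Matrix.det_succ_column_zero, Fin.sum_univ_succ]
  simp
  rfl

lemma mem_convexHull_range_iff {ι E : Type*} [Fintype ι] [AddCommGroup E] [Module ℝ E]
    (w : ι → E) (x : E) : x ∈ convexHull ℝ (Set.range w) ↔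
      ∃ c : ι → ℝ, (∀ i, 0 ≤ c i) ∧ ∑ i, c i = 1 ∧ ∑ i, c i • w i = x := by
  constructor
  · intro hx
    rw [convexHull_range_eq_exists_affineCombination] at hx
    obtain ⟨s, c, h0, h1, rfl⟩ := hx
    classical
    refine ⟨fun i => if i ∈ s then c i else 0, fun i => ?_, ?_, ?_⟩
    · dsimp only; split_ifs with h
      exacts [h0 i h, le_rfl]
    · simpa using h1
    · rw [Finset.affineCombination_eq_linear_combination _ _ _ h1]
      simp [ite_smul]
  · rintro ⟨c, h0, h1, rfl⟩
    exact (convex_convexHull ℝ _).sum_mem (fun i _ => h0 i) h1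
      fun i _ => subset_convexHull _ _ ⟨i, rfl⟩

lemma convexHull_range_eq_image_cornerSimplex {d : ℕ} (w : Fin (d + 1) → Fin d → ℝ) :
    convexHull ℝ (Set.range w) = (fun x => w 0 + x) ''
      (Matrix.toLin' (Matrix.of fun i : Fin d => w i.succ - w 0)ᵀ '' cornerSimplex d 1) := by
  have key : ∀ c : Fin d → ℝ, Matrix.toLin' (Matrix.of fun i : Fin d => w i.succ - w 0)ᵀ c =
      ∑ i, c i • (w i.succ - w 0) := by
    intro c
    rw [Matrix.toLin'_apply, Matrix.mulVec_transpose]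
    ext j
    simp [Matrix.vecMul, dotProduct]
  ext x
  rw [mem_convexHull_range_iff, Set.image_image]
  constructor
  · rintro ⟨c, h0, h1, rfl⟩
    rw [Fin.sum_univ_succ] at h1
    refine ⟨fun i => c i.succ, ⟨fun i => h0 _, by linarith [h0 0]⟩, ?_⟩
    dsimp only
    rw [key, Fin.sum_univ_succ, eq_sub_iff_add_eq.2 h1]
    simp only [smul_sub, Finset.sum_sub_distrib, ← Finset.sum_smul, sub_smul, one_smul]
    abel
  · rintro ⟨c, ⟨h0, h1⟩, rfl⟩
    refine ⟨Fin.cons (1 - ∑ i, c i) c, Fin.cases (by simpa using h1) (by simpa using h0),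
      by simp [Fin.sum_univ_succ], ?_⟩
    dsimp only
    rw [key, Fin.sum_univ_succ]
    simp only [Fin.cons_zero, Fin.cons_succ, smul_sub, Finset.sum_sub_distrib, ← Finset.sum_smul,
      sub_smul, one_smul]
    abel

/-- The normalized volume of `conv(w_0, …, w_d)` is the absolute value of the determinant with
rows `(1, w_i)`; degenerate configurations are included, both sides being zero. -/
lemma normalizedVolume_convexHull {d : ℕ} (w : Fin (d + 1) → Fin d → ℝ) :
    normalizedVolume (convexHull ℝ (Set.range fun i => (WithLp.toLp 2 (w i) :
      EuclideanSpace ℝ (Fin d)))) = |(homMatrix w).det| := by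
  have himg : (WithLp.ofLp (p := 2) (V := Fin d → ℝ)) ⁻¹' (convexHull ℝ (Set.range w)) =
      convexHull ℝ (Set.range fun i => (WithLp.toLp 2 (w i) : EuclideanSpace ℝ (Fin d))) := by
    have h := (WithLp.linearEquiv 2 ℝ (Fin d → ℝ)).symm.toLinearMap.image_convexHull (Set.range w)
    rw [← Set.range_comp] at h
    refine Eq.trans ?_ h
    exact ((WithLp.linearEquiv 2 ℝ (Fin d → ℝ)).symm.toEquiv.image_eq_preimage_symm _).symm
  have hvol : volume (convexHull ℝ (Set.range fun i => (WithLp.toLp 2 (w i) :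
      EuclideanSpace ℝ (Fin d)))) = volume (convexHull ℝ (Set.range w)) := by
    rw [← himg]
    exact (EuclideanSpace.volume_preserving_symm_measurableEquiv_toLp
      (Fin d)).measure_preimage_equiv _
  rw [normalizedVolume, hvol, convexHull_range_eq_image_cornerSimplex, Set.image_add_left,
    measure_preimage_add, Measure.addHaar_image_linearMap, volume_cornerSimplex _ zero_le_one,
    LinearMap.det_toLin', Matrix.det_transpose, ← det_homMatrix, ENNReal.toReal_mul,
    ENNReal.toReal_ofReal (abs_nonneg _), ENNReal.toReal_ofReal (by positivity)]
  have := Nat.cast_ne_zero (R := ℝ).2 d.factorial_ne_zero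
  field_simp
  simp


/-! ### Recognizing lattice pyramids -/

/-- The affine map `x ↦ xU + w` of `ℝ^d`. -/
def rowAffineMap {d : ℕ} (U : Matrix (Fin d) (Fin d) ℤ) (w : Fin d → ℤ) :
    EuclideanSpace ℝ (Fin d) →ᵃ[ℝ] EuclideanSpace ℝ (Fin d) where
  toFun x := WithLp.toLp 2 (Matrix.vecMul x.ofLp (U.map (fun a : ℤ => (a : ℝ)))) + latticePt w
  linear := ((WithLp.linearEquiv 2 ℝ (Fin d → ℝ)).symm.toLinearMap ∘ₗ
    Matrix.vecMulLinear (U.map (fun a : ℤ => (a : ℝ)))) ∘ₗ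
      (WithLp.linearEquiv 2 ℝ (Fin d → ℝ)).toLinearMap
  map_vadd' p x := by
    simp [Matrix.add_vecMul, add_assoc]

/-- The embedding `x ↦ (x, 0)` of `ℝ^n` as a coordinate hyperplane. -/
def snocZero (n : ℕ) : EuclideanSpace ℝ (Fin n) →ₗ[ℝ] EuclideanSpace ℝ (Fin (n + 1)) where
  toFun x := WithLp.toLp 2 (Fin.snoc (α := fun _ => ℝ) x.ofLp 0)
  map_add' x y := by
    ext j
    refine Fin.lastCases ?_ (fun j => ?_) j <;> simp
  map_smul' c x := by
    ext j
    refine Fin.lastCases ?_ (fun j => ?_) j <;> simp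

lemma rowAffineMap_latticePt {d : ℕ} (U : Matrix (Fin d) (Fin d) ℤ) (w z : Fin d → ℤ) :
    rowAffineMap U w (latticePt z) = latticePt (z ᵥ* U + w) := by
  ext j
  simp [rowAffineMap, latticePt, Matrix.vecMul, dotProduct]

lemma snocZero_latticePt {n : ℕ} (z : Fin n → ℤ) :
    snocZero n (latticePt z) = latticePt (Fin.snoc (α := fun _ => ℤ) z 0) := by
  ext j
  refine Fin.lastCases ?_ (fun j => ?_) j <;> simp [snocZero, latticePt]

lemma single_last_eq_latticePt (n : ℕ) :
    EuclideanSpace.single (Fin.last n) (1 : ℝ) =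
      latticePt (Fin.snoc (α := fun _ => ℤ) (0 : Fin n → ℤ) 1) := by
  ext j
  refine Fin.lastCases ?_ (fun j => ?_) j <;> simp [latticePt]

lemma pyramid_simplex {n : ℕ} (u : Fin (n + 1) → Fin n → ℤ) :
    pyramid (simplex u) = convexHull ℝ (insert (EuclideanSpace.single (Fin.last n) (1 : ℝ))
      (Set.range fun j => snocZero n (latticePt (u j)))) := by
  have h := (snocZero n).image_convexHull (Set.range fun j => latticePt (u j))
  rw [← Set.range_comp] at h
  change convexHull ℝ (insert _ (snocZero n '' (convexHull ℝ (Set.range fun j => latticePt (u j)))))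
    = _
  rw [h, Set.insert_eq, Set.insert_eq, convexHull_convexHull_union_right]
  rfl

/-- A primitive integral functional vanishing on differences of vertices of a facet and equal to `1`
on the remaining edge direction exhibits the simplex as a lattice pyramid over that facet. -/
lemma isLatticePyramid_of_functional {d : ℕ} {v : Fin (d + 1) → Fin d → ℤ}
    (hv : IsLatticeSimplex v) {i k₀ : Fin (d + 1)} (hk₀ : k₀ ≠ i) (a : Fin d → ℤ)
    (h0 : ∀ k ≠ i, a ⬝ᵥ (v k - v k₀) = 0) (h1 : a ⬝ᵥ (v i - v k₀) = 1) :
    IsLatticePyramid (simplex v) := by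
  obtain _ | n := d
  · exact absurd (Subsingleton.elim (α := Fin 1) k₀ i) hk₀
  set A : (Fin (n + 1) → ℤ) →ₗ[ℤ] ℤ := dotProductBilin ℤ ℤ a with hA
  have hAapp : ∀ z, A z = a ⬝ᵥ z := fun z => rfl
  have hsurj : Function.Surjective A := fun c => ⟨c • (v i - v k₀), by
    rw [map_smul, hAapp, h1]; simp⟩
  have hrank : Module.finrank ℤ (LinearMap.ker A) = n := by
    have h := Submodule.finrank_quotient_add_finrank (LinearMap.ker A)
    rw [(A.quotKerEquivOfSurjective hsurj).finrank_eq, Module.finrank_self, Module.finrank_fin_fun]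
      at h
    omega
  let b : Module.Basis (Fin n) ℤ (LinearMap.ker A) := Module.finBasisOfFinrankEq ℤ _ hrank
  -- A basis of the kernel, completed by the edge direction, is a basis of `ℤ^(n+1)`.
  let B : Module.Basis (Fin (n + 1)) ℤ (Fin (n + 1) → ℤ) := b.mkFinSnoc (v i - v k₀)
    (fun c x hx hc => by
      have := congrArg A hc
      rw [map_add, map_smul, LinearMap.mem_ker.1 hx, hAapp, h1] at this
      simpa using this)
    (fun z => ⟨-A z, by
      rw [LinearMap.mem_ker, map_add, map_smul, hAapp (v i - v k₀), h1]; simp⟩)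
  have hB : (B : Fin (n + 1) → Fin (n + 1) → ℤ) = Fin.snoc ((↑) ∘ b) (v i - v k₀) :=
    Module.Basis.coe_mkFinSnoc _ _ _ _
  let U : Matrix (Fin (n + 1)) (Fin (n + 1)) ℤ := Matrix.of B
  have hUdet : U.det = 1 ∨ U.det = -1 := by
    have h := (Pi.basisFun ℤ (Fin (n + 1))).isUnit_det B
    rw [Module.Basis.det_apply, ← Matrix.det_transpose, Int.isUnit_iff] at h
    exact h
  have hUmul : ∀ z : Fin (n + 1) → ℤ, z ᵥ* U = ∑ k, z k • B k := by
    intro z; ext j; simp [Matrix.vecMul, dotProduct, U]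
  have hmem : ∀ j, v (i.succAbove j) - v k₀ ∈ LinearMap.ker A := fun j =>
    LinearMap.mem_ker.2 (h0 _ (Fin.succAbove_ne i j))
  let u : Fin (n + 1) → Fin n → ℤ := fun j => b.repr ⟨_, hmem j⟩
  have hfac : ∀ j, rowAffineMap U (v k₀) (snocZero n (latticePt (u j))) =
      latticePt (v (i.succAbove j)) := by
    intro j
    rw [snocZero_latticePt, rowAffineMap_latticePt, hUmul, Fin.sum_univ_castSucc, hB]
    have h := congrArg Subtype.val (b.sum_repr ⟨_, hmem j⟩)
    simp only [Submodule.coe_sum, Submodule.coe_smul] at h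
    simp only [Fin.snoc_castSucc, Fin.snoc_last, zero_smul, add_zero, Function.comp_apply]
    congr 1
    exact (congrArg (· + v k₀) h).trans (sub_add_cancel _ _)
  have hapex : rowAffineMap U (v k₀) (EuclideanSpace.single (Fin.last n) (1 : ℝ)) =
      latticePt (v i) := by
    rw [single_last_eq_latticePt, rowAffineMap_latticePt, hUmul, Fin.sum_univ_castSucc, hB]
    simp
  refine ⟨u, ?_, U, v k₀, hUdet, ?_⟩
  · refine AffineIndependent.of_comp
      ((rowAffineMap U (v k₀)).comp (snocZero n).toAffineMap) ?_
    have : ((rowAffineMap U (v k₀)).comp (snocZero n).toAffineMap) ∘ (fun j => latticePt (u j)) =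
        (fun k => latticePt (v k)) ∘ i.succAbove := funext hfac
    rw [this]
    exact AffineIndependent.comp_embedding i.succAboveEmb hv
  · change _ = (rowAffineMap U (v k₀)) '' _
    rw [pyramid_simplex, AffineMap.image_convexHull, Set.image_insert_eq, hapex, ← Set.range_comp]
    have : (rowAffineMap U (v k₀)) ∘ (fun j => snocZero n (latticePt (u j))) =
        (fun k => latticePt (v k)) ∘ i.succAbove := funext hfac
    rw [this, simplex, Set.range_comp, Fin.range_succAbove,
      ← Set.image_insert_eq (f := fun k => latticePt (v k)), Set.insert_eq, Set.union_compl_self,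
      Set.image_univ]


/-! ### The group attached to a simplex -/

/-- The kernel of an integral square matrix acting (by right multiplication of row vectors) on the
torus `(ℝ/ℤ)^ι`. -/
def torusKernel {ι : Type*} [Fintype ι] (M : Matrix ι ι ℤ) : AddSubgroup (ι → UnitAddCircle) where
  carrier := {l | ∀ j, ∑ i, M i j • l i = 0}
  zero_mem' := by simp
  add_mem' := by
    intro a b ha hb j
    simp [smul_add, Finset.sum_add_distrib, ha j, hb j]
  neg_mem' := by
    intro a ha j
    simp [ha j]

lemma coe_mem_torusKernel_iff {ι : Type*} [Fintype ι] (M : Matrix ι ι ℤ) (L : ι → ℝ) :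
    (fun i => (L i : UnitAddCircle)) ∈ torusKernel M ↔
      ∃ z : ι → ℤ, L ᵥ* M.map (Int.cast : ℤ → ℝ) = fun j => (z j : ℝ) := by
  have key : ∀ j, ∑ i, M i j • (L i : UnitAddCircle) =
      (((L ᵥ* M.map (Int.cast : ℤ → ℝ)) j : ℝ) : UnitAddCircle) := by
    intro j
    simp only [Matrix.vecMul, dotProduct, Matrix.map_apply]
    rw [← QuotientAddGroup.mk'_apply, map_sum]
    refine Finset.sum_congr rfl fun i _ => ?_
    rw [QuotientAddGroup.mk'_apply, mul_comm, ← zsmul_eq_mul]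
    rfl
  change (∀ j, ∑ i, M i j • (L i : UnitAddCircle) = 0) ↔ _
  simp only [key, AddCircle.coe_eq_zero_iff]
  constructor
  · intro h
    choose z hz using h
    exact ⟨z, funext fun j => by simp [← hz]⟩
  · rintro ⟨z, hz⟩ j
    exact ⟨z j, by simp [hz]⟩

/-- The torus kernel is dual to the cokernel of the matrix: sending an integral vector `z` to the
class of `z M⁻¹` identifies it with `ℤ^ι / ℤ^ι M`. -/
lemma natCard_torusKernel {ι : Type*} [Fintype ι] [DecidableEq ι] (M : Matrix ι ι ℤ)
    (hM : M.det ≠ 0) : Nat.card (torusKernel M) = M.det.natAbs := by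
  set R : Matrix ι ι ℝ := M.map (Int.cast : ℤ → ℝ) with hR
  have hRdet : IsUnit R.det := by
    have : R.det = (M.det : ℝ) := ((Int.castRingHom ℝ).map_det M).symm
    rw [this]; exact (Int.cast_ne_zero.2 hM).isUnit
  let φ : (ι → ℤ) →+ (ι → UnitAddCircle) :=
    { toFun := fun z i => ((((fun j => (z j : ℝ)) ᵥ* R⁻¹) i : ℝ) : UnitAddCircle)
      map_zero' := by
        ext i
        have : (fun j => (((0 : ι → ℤ) j : ℤ) : ℝ)) = 0 := by ext; simp
        rw [this]; simp
      map_add' := by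
        intro x y; ext i
        have : (fun j => (((x + y) j : ℤ) : ℝ)) = (fun j => (x j : ℝ)) + fun j => (y j : ℝ) := by
          ext; simp
        rw [this, Matrix.add_vecMul]; simp }
  have hrange : φ.range = torusKernel M := by
    ext l
    constructor
    · rintro ⟨z, rfl⟩
      refine (coe_mem_torusKernel_iff M _).2 ⟨z, ?_⟩
      rw [Matrix.vecMul_vecMul, Matrix.nonsing_inv_mul _ hRdet, Matrix.vecMul_one]
    · intro hl
      obtain ⟨L, rfl⟩ : ∃ L : ι → ℝ, l = fun i => (L i : UnitAddCircle) :=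
        ⟨fun i => (l i).out, funext fun i => (Quotient.out_eq _).symm⟩
      obtain ⟨z, hz⟩ := (coe_mem_torusKernel_iff M L).1 hl
      refine ⟨z, funext fun i => ?_⟩
      change ((((fun j => (z j : ℝ)) ᵥ* R⁻¹) i : ℝ) : UnitAddCircle) = _
      rw [← hz, Matrix.vecMul_vecMul, Matrix.mul_nonsing_inv _ hRdet, Matrix.vecMul_one]
  let f : (ι → ℤ) →ₗ[ℤ] (ι → ℤ) := Matrix.toLin' Mᵀ
  have hfapp : ∀ z, f z = z ᵥ* M := fun z => by
    rw [Matrix.toLin'_apply, Matrix.mulVec_transpose]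
  have hcast : ∀ z : ι → ℤ, (fun j => ((z ᵥ* M) j : ℝ)) = (fun j => (z j : ℝ)) ᵥ* R := by
    intro z; ext j; simp [Matrix.vecMul, dotProduct, hR]
  have hker : φ.ker = (LinearMap.range f).toAddSubgroup := by
    ext z
    rw [AddMonoidHom.mem_ker]
    constructor
    · intro h
      have h' : ∀ i, ∃ n : ℤ, n • (1 : ℝ) = ((fun j => (z j : ℝ)) ᵥ* R⁻¹) i := fun i =>
        (AddCircle.coe_eq_zero_iff 1).1 (congrFun h i)
      choose n hn using h'
      refine ⟨n, ?_⟩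
      rw [hfapp]
      have h2 : (fun j => (n j : ℝ)) = (fun j => (z j : ℝ)) ᵥ* R⁻¹ := by
        ext i; rw [← hn]; simp
      have h3 := hcast n
      rw [h2, Matrix.vecMul_vecMul, Matrix.nonsing_inv_mul _ hRdet, Matrix.vecMul_one] at h3
      ext j
      exact_mod_cast congrFun h3 j
    · rintro ⟨n, rfl⟩
      ext i
      change ((((fun j => (f n j : ℝ)) ᵥ* R⁻¹) i : ℝ) : UnitAddCircle) = 0
      rw [hfapp, hcast, Matrix.vecMul_vecMul, Matrix.mul_nonsing_inv _ hRdet, Matrix.vecMul_one]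
      exact (AddCircle.coe_eq_zero_iff 1).2 ⟨n i, by simp⟩
  have hfdet : LinearMap.det f = M.det := by
    rw [LinearMap.det_toLin', Matrix.det_transpose]
  have hinj : Function.Injective f := by
    intro x y hxy
    rw [hfapp, hfapp, ← sub_eq_zero, ← Matrix.sub_vecMul] at hxy
    exact sub_eq_zero.1 (Matrix.eq_zero_of_vecMul_eq_zero hM hxy)
  have hcard := Submodule.natAbs_det_equiv (LinearMap.range f) (LinearEquiv.ofInjective f hinj)
  have hcomp : (LinearMap.range f).subtype ∘ₗ AddMonoidHom.toIntLinearMap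
      ((LinearEquiv.ofInjective f hinj : (ι → ℤ) ≃ₗ[ℤ] LinearMap.range f) :
        (ι → ℤ) →+ LinearMap.range f) = f := by
    ext; rfl
  rw [hcomp, hfdet] at hcard
  rw [hcard, ← hrange, ← AddSubgroup.index_ker, hker]
  rfl

lemma Lam_eq_torusKernel {d : ℕ} (v : Fin (d + 1) → Fin d → ℤ) :
    Lam v = torusKernel (homMatrix v) := by
  ext l
  change ((∀ j, ∑ i, v i j • l i = 0) ∧ ∑ i, l i = 0) ↔ ∀ j, ∑ i, homMatrix v i j • l i = 0
  rw [Fin.forall_fin_succ, and_comm]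
  simp

/-- If every element of a group of order `pq` in the torus is killed coordinatewise by `m`, and the
group contains `(1/m_i)_i`, then the latter generates the group and every `m_i` divides `pq`. -/
lemma eq_zmultiples_of_forall_nsmul {ι : Type*} {p q : ℕ} (hp : p.Prime) (hq : q.Prime)
    (hpq : p ≠ q) (H : AddSubgroup (ι → UnitAddCircle)) (hcard : Nat.card H = p * q)
    (m : ι → ℕ) (hm : ∀ i, 0 < m i) (hkill : ∀ l ∈ H, ∀ i, m i • l i = 0)
    (hmem : (fun i => ((1 / (m i : ℝ) : ℝ) : UnitAddCircle)) ∈ H) :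
    H = AddSubgroup.zmultiples (fun i => ((1 / (m i : ℝ) : ℝ) : UnitAddCircle)) ∧
      ∀ i, m i ∣ p * q := by
  set β : ι → UnitAddCircle := fun i => ((1 / (m i : ℝ) : ℝ) : UnitAddCircle) with hβ
  have hord : ∀ i, addOrderOf (β i) = m i := fun i => AddCircle.addOrderOf_period_div (hm i)
  have hdvd : ∀ i, m i ∣ addOrderOf β := fun i => by
    rw [← hord i]
    exact addOrderOf_dvd_of_nsmul_eq_zero (congrFun (addOrderOf_nsmul_eq_zero β) i)
  have hpos : 0 < p * q := Nat.mul_pos hp.pos hq.pos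
  have hfin : Finite H := Nat.finite_of_card_ne_zero (by rw [hcard]; exact hpos.ne')
  have hdvd' : addOrderOf β ∣ p * q := by
    rw [← hcard, ← AddSubgroup.addOrderOf_mk β hmem]
    exact addOrderOf_dvd_natCard _
  have hprime : ∀ ℓ : ℕ, ℓ.Prime → ℓ ∣ p * q → ℓ ∣ addOrderOf β := by
    intro ℓ hℓ hℓd
    have : Fact ℓ.Prime := ⟨hℓ⟩
    obtain ⟨⟨x, hx⟩, hxo⟩ := exists_prime_addOrderOf_dvd_card' (G := H) ℓ (by rwa [hcard])
    rw [AddSubgroup.addOrderOf_mk] at hxo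
    have hx0 : x ≠ 0 := by
      rintro rfl
      rw [addOrderOf_zero] at hxo
      exact hℓ.one_lt.ne hxo
    obtain ⟨i, hi⟩ := Function.ne_iff.1 hx0
    have h1 : ℓ • x i = 0 := by
      rw [← hxo]; exact congrFun (addOrderOf_nsmul_eq_zero x) i
    have h2 : addOrderOf (x i) = ℓ := (Nat.dvd_prime hℓ).1 (addOrderOf_dvd_of_nsmul_eq_zero h1)
      |>.resolve_left fun h => hi (AddMonoid.addOrderOf_eq_one_iff.1 h)
    have h3 := addOrderOf_dvd_of_nsmul_eq_zero (hkill x hx i)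
    rw [h2] at h3
    exact h3.trans (hdvd i)
  have hpqd : p * q ∣ addOrderOf β :=
    ((Nat.coprime_primes hp hq).2 hpq).mul_dvd_of_dvd_of_dvd (hprime p hp (dvd_mul_right _ _))
      (hprime q hq (dvd_mul_left _ _))
  refine ⟨?_, fun i => (hdvd i).trans hdvd'⟩
  refine (AddSubgroup.eq_of_le_of_card_ge (AddSubgroup.zmultiples_le_of_mem hmem) ?_).symm
  rw [hcard, Nat.card_zmultiples]
  exact Nat.le_of_dvd (Nat.pos_of_dvd_of_pos hdvd' hpos) hpqd


/-! ### The polar dual of a simplex containing the origin in its interior -/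

lemma polarDual_convexHull_range {d : ℕ} {ι : Type*} (W : ι → EuclideanSpace ℝ (Fin d)) :
    polarDual (convexHull ℝ (Set.range W)) = {y | ∀ k, inner ℝ (W k) y ≤ 1} := by
  ext y
  constructor
  · intro h k
    exact h _ (subset_convexHull _ _ ⟨k, rfl⟩)
  · intro h
    have hconv : Convex ℝ {x : EuclideanSpace ℝ (Fin d) | inner ℝ x y ≤ 1} :=
      convex_halfSpace_le ⟨fun a b => inner_add_left a b y,
        fun c a => real_inner_smul_left a y c⟩ 1
    exact fun x hx => convexHull_min (by rintro _ ⟨k, rfl⟩; exact h k) hconv hx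

section

variable {d : ℕ} {ι : Type*} [Fintype ι] {W y : ι → EuclideanSpace ℝ (Fin d)} {b : ι → ℝ} {r : ℝ}

/-- If the vertices `W_k` of a simplex satisfy `∑ b_k W_k = 0` with positive `b_k` of sum `r`, then
the points `y_i` with `⟨W_k, y_i⟩ = 1 - δ_{ik} r / b_i` span the polar dual. -/
lemma polarDual_eq_convexHull [DecidableEq ι] (hb : ∀ i, 0 < b i) (hr : 0 < r)
    (hbsum : ∑ i, b i = r)
    (hbW : ∑ i, b i • W i = 0) (hspan : ∀ x, (∀ k, inner ℝ (W k) x = 0) → x = 0)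
    (hy : ∀ k i, inner ℝ (W k) (y i) = 1 - if k = i then r / b i else 0) :
    polarDual (convexHull ℝ (Set.range W)) = convexHull ℝ (Set.range y) := by
  rw [polarDual_convexHull_range]
  ext x
  rw [mem_convexHull_range_iff]
  have hcomb : ∀ c : ι → ℝ, ∑ i, c i = 1 → ∀ k, inner ℝ (W k) (∑ i, c i • y i) =
      1 - c k * (r / b k) := by
    intro c hc k
    simp only [inner_sum, real_inner_smul_right, hy, mul_sub, Finset.sum_sub_distrib, mul_one, hc]
    simp
  constructor
  · intro hx
    have hsum : ∑ k, b k * (1 - inner ℝ (W k) x) = r := by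
      have h := congrArg (fun z => inner ℝ z x) hbW
      simp only [sum_inner, real_inner_smul_left, inner_zero_left] at h
      simp [mul_sub, Finset.sum_sub_distrib, h, hbsum]
    have hc1 : ∑ k, b k * (1 - inner ℝ (W k) x) / r = 1 := by
      rw [← Finset.sum_div, hsum, div_self hr.ne']
    refine ⟨fun k => b k * (1 - inner ℝ (W k) x) / r, fun k => ?_, hc1, ?_⟩
    · have := sub_nonneg.2 (hx k)
      have := hb k
      positivity
    · refine sub_eq_zero.1 (hspan _ fun k => ?_)
      rw [inner_sub_right, hcomb _ hc1]
      have := (hb k).ne'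
      field_simp
      ring
  · rintro ⟨c, hc0, hc1, rfl⟩ k
    rw [hcomb c hc1]
    have := mul_nonneg (hc0 k) (div_pos hr (hb k)).le
    linarith

/-- The points spanning the polar dual are its vertices. -/
lemma mem_extremePoints_polarDual [DecidableEq ι] (hb : ∀ i, 0 < b i) (hr : 0 < r)
    (hbW : ∑ i, b i • W i = 0) (hspan : ∀ x, (∀ k, inner ℝ (W k) x = 0) → x = 0)
    (hy : ∀ k i, inner ℝ (W k) (y i) = 1 - if k = i then r / b i else 0) (i : ι) :
    y i ∈ (polarDual (convexHull ℝ (Set.range W))).extremePoints ℝ := by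
  rw [polarDual_convexHull_range, mem_extremePoints_iff_left]
  refine ⟨fun k => ?_, ?_⟩
  · rw [hy]
    split_ifs with h
    · have := div_pos hr (hb i)
      linarith
    · simp
  · rintro x₁ hx₁ x₂ hx₂ ⟨α, β, hα, hβ, hαβ, hx⟩
    have hne : ∀ k, k ≠ i → inner ℝ (W k) (x₁ - y i) = 0 := by
      intro k hk
      have h := hy k i
      rw [← hx, inner_add_right, real_inner_smul_right, real_inner_smul_right, if_neg hk] at h
      rw [inner_sub_right, hy, if_neg hk]
      have h1 := hx₁ k
      have h2 := hx₂ k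
      have : α * (1 - inner ℝ (W k) x₁) = 0 := by nlinarith
      have := (mul_eq_zero.1 this).resolve_left hα.ne'
      linarith
    -- The remaining pairing is determined by the linear relation between the vertices.
    refine sub_eq_zero.1 (hspan _ fun k => ?_)
    by_cases hk : k = i
    · subst hk
      have h := congrArg (fun z => inner ℝ z (x₁ - y k)) hbW
      simp only [sum_inner, real_inner_smul_left, inner_zero_left] at h
      rw [Finset.sum_eq_single k (fun j _ hj => by rw [hne j hj, mul_zero]) (by simp)] at h
      exact (mul_eq_zero.1 h).resolve_left (hb k).ne'
    · exact hne k hk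

end

section

variable {d : ℕ} (w : Fin (d + 1) → Fin d → ℝ) (b : Fin (d + 1) → ℝ)

/-- The vertices of the dual of the translate `r • conv(w) - τ`, where `(r, τ) = ∑ b_i (1, w_i)`:
minus the linear parts of the barycentric coordinate functions, divided by the `b_i`. -/
noncomputable def dualVertex (i : Fin (d + 1)) : Fin d → ℝ := fun j =>
  -((homMatrix w)⁻¹ j.succ i / b i)

variable {w b} {r : ℝ} {τ : Fin d → ℝ}

lemma dotProduct_dualVertex (hw : (homMatrix w).det ≠ 0) (hb : ∀ i, 0 < b i)
    (hbsum : ∑ i, b i = r) (hbτ : ∑ i, b i • w i = τ) (k i : Fin (d + 1)) :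
    (r • w k - τ) ⬝ᵥ dualVertex w b i = 1 - if k = i then r / b i else 0 := by
  set C := (homMatrix w)⁻¹ with hC
  have hw1 : ∀ k, C 0 i + w k ⬝ᵥ (fun j => C j.succ i) = if k = i then 1 else 0 := by
    intro k
    have h := congrFun (congrFun (Matrix.mul_nonsing_inv _ hw.isUnit) k) i
    rw [Matrix.mul_apply, Fin.sum_univ_succ, Matrix.one_apply] at h
    simpa [dotProduct] using h
  have hτ : r * C 0 i + τ ⬝ᵥ (fun j => C j.succ i) = b i := by
    have h : ∑ k, b k * (C 0 i + w k ⬝ᵥ (fun j => C j.succ i)) = b i := by simp [hw1]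
    rw [← h, ← hbτ, ← hbsum, sum_dotProduct]
    simp [mul_add, Finset.sum_add_distrib, Finset.sum_mul]
  have hy : dualVertex w b i = (-(b i)⁻¹) • fun j => C j.succ i := by
    ext j
    simp only [dualVertex, Pi.smul_apply, smul_eq_mul, hC]
    ring
  have hbi := (hb i).ne'
  rw [hy, dotProduct_smul, sub_dotProduct, smul_dotProduct, eq_sub_of_add_eq' (hw1 k),
    eq_sub_of_add_eq' hτ]
  simp only [smul_eq_mul]
  split_ifs <;> field_simp <;> ring

lemma det_homMatrix_smul_sub (r : ℝ) (τ : Fin d → ℝ) (w : Fin (d + 1) → Fin d → ℝ) :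
    (homMatrix fun k => r • w k - τ).det = r ^ d * (homMatrix w).det := by
  rw [det_homMatrix, det_homMatrix]
  have : (Matrix.of fun i : Fin d => (r • w i.succ - τ) - (r • w 0 - τ)) =
      r • Matrix.of fun i : Fin d => w i.succ - w 0 := by
    ext i j; simp; ring
  rw [this, Matrix.det_smul, Fintype.card_fin]

lemma eq_zero_of_forall_dotProduct_eq_zero {W : Fin (d + 1) → Fin d → ℝ}
    (hW : (homMatrix W).det ≠ 0) (x : Fin d → ℝ) (hx : ∀ k, W k ⬝ᵥ x = 0) : x = 0 := by
  have h : homMatrix W *ᵥ Fin.cons 0 x = 0 := by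
    ext k
    rw [Matrix.mulVec, dotProduct, Fin.sum_univ_succ]
    simpa [dotProduct] using hx k
  have h2 := Matrix.eq_zero_of_mulVec_eq_zero hW h
  ext j
  exact congrFun h2 j.succ

lemma abs_det_homMatrix_dualVertex (hw : (homMatrix w).det ≠ 0) (hb : ∀ i, 0 < b i)
    (hr : 0 < r) (hbsum : ∑ i, b i = r) (hbτ : ∑ i, b i • w i = τ) :
    |(homMatrix (dualVertex w b)).det| = r / ((∏ i, b i) * |(homMatrix w).det|) := by
  -- Pairing the rows `(1, y_i)` with the rows `(-1, W_k)` gives a diagonal matrix.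
  have hmul : homMatrix (dualVertex w b) * (Matrix.diagonal (Fin.cons (-1) 1) *
      (homMatrix fun k => r • w k - τ)ᵀ) = Matrix.diagonal fun i => -(r / b i) := by
    ext i k
    rw [Matrix.mul_apply, Fin.sum_univ_succ]
    have h := dotProduct_dualVertex hw hb hbsum hbτ k i
    rw [dotProduct_comm] at h
    simp only [dotProduct] at h
    simp only [Matrix.diagonal_mul, Matrix.transpose_apply, homMatrix_zero, homMatrix_succ,
      Fin.cons_zero, Fin.cons_succ, Pi.one_apply, one_mul, h, Matrix.diagonal_apply]
    by_cases hik : i = k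
    · simp only [hik, if_true]; ring
    · simp [hik, Ne.symm hik]
  have hdet := congrArg (fun A => |Matrix.det A|) hmul
  simp only [Matrix.det_mul, Matrix.det_diagonal, Matrix.det_transpose, det_homMatrix_smul_sub,
    abs_mul, Finset.abs_prod, abs_neg, Fin.prod_univ_succ (n := d) (f := Fin.cons _ _)] at hdet
  have hr' : ∀ i, |r / b i| = r / b i := fun i => abs_of_pos (div_pos hr (hb i))
  have hprod := Finset.prod_pos fun i (_ : i ∈ Finset.univ) => hb i
  simp only [hr', Finset.prod_div_distrib, Finset.prod_const, Finset.card_univ, Fintype.card_fin,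
    abs_pow, abs_of_pos hr, Fin.cons_zero, Fin.cons_succ, Pi.one_apply, abs_one, abs_neg, one_pow,
    mul_one] at hdet
  have hw' := abs_pos.2 hw
  have hrd := pow_pos hr d
  rw [pow_succ] at hdet
  rw [eq_div_iff (by positivity)]
  field_simp at hdet
  linarith

end


/-! ### The weights of a Gorenstein simplex -/

lemma inner_toLp {d : ℕ} (x y : Fin d → ℝ) :
    inner ℝ (WithLp.toLp 2 x : EuclideanSpace ℝ (Fin d)) (WithLp.toLp 2 y) = x ⬝ᵥ y := by
  simp [PiLp.inner_apply, dotProduct, mul_comm]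

lemma homMatrix_map_intCast {d : ℕ} (v : Fin (d + 1) → Fin d → ℤ) :
    (homMatrix v).map (Int.cast : ℤ → ℝ) = homMatrix fun k j => (v k j : ℝ) := by
  ext i j
  refine Fin.cases ?_ (fun j => ?_) j <;> simp

lemma det_homMatrix_intCast {d : ℕ} (v : Fin (d + 1) → Fin d → ℤ) :
    (homMatrix fun k j => (v k j : ℝ)).det = ((homMatrix v).det : ℝ) := by
  rw [← homMatrix_map_intCast]
  exact ((Int.castRingHom ℝ).map_det (homMatrix v)).symm

lemma normalizedVolume_simplex {d : ℕ} (v : Fin (d + 1) → Fin d → ℤ) :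
    normalizedVolume (simplex v) = ((homMatrix v).det.natAbs : ℝ) := by
  rw [Nat.cast_natAbs, Int.cast_abs, ← det_homMatrix_intCast, ← normalizedVolume_convexHull]
  rfl

lemma exists_pos_coords_of_mem_interior {d : ℕ} {v : Fin (d + 1) → Fin d → ℤ}
    (hv : IsLatticeSimplex v) {r : ℝ} (hr : 0 < r) {t : EuclideanSpace ℝ (Fin d)}
    (ht : t ∈ interior (r • simplex v)) :
    ∃ b : Fin (d + 1) → ℝ, (∀ i, 0 < b i) ∧ ∑ i, b i = r ∧ ∑ i, b i • latticePt (v i) = t := by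
  let B : AffineBasis (Fin (d + 1)) ℝ (EuclideanSpace ℝ (Fin d)) :=
    ⟨fun i => latticePt (v i), hv, by
      rw [hv.affineSpan_eq_top_iff_card_eq_finrank_add_one]; simp⟩
  rw [interior_smul₀ hr.ne'] at ht
  obtain ⟨x, hx, rfl⟩ := ht
  have hx' : ∀ i, 0 < B.coord i x := by
    have h := B.interior_convexHull
    exact (Set.ext_iff.1 h x).1 hx
  refine ⟨fun i => r * B.coord i x, fun i => mul_pos hr (hx' i), ?_, ?_⟩
  · rw [← Finset.mul_sum, B.sum_coord_apply_eq_one, mul_one]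
  · simp only [mul_smul, ← Finset.smul_sum]
    congr 1
    exact B.linear_combination_coord_eq_self x

/-- The reflexive translate of `rP` is the one moving its only interior lattice point `t` to the
origin, so the dual of `rP - t` is a lattice polytope. -/
lemma isLatticePolytope_polarDual {d r : ℕ} {P : Set (EuclideanSpace ℝ (Fin d))}
    (hG : IsGorenstein r P) {t : EuclideanSpace ℝ (Fin d)}
    (ht : interior ((r : ℝ) • P) ∩ latticePoints d = {t}) :
    IsLatticePolytope (polarDual ((fun x => x - t) '' ((r : ℝ) • P))) := by
  obtain ⟨-, -, Q, w, ⟨-, hQint, hQdual⟩, hQ⟩ := hG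
  have h0 : (0 : EuclideanSpace ℝ (Fin d)) ∈ interior Q := by
    have h : (0 : EuclideanSpace ℝ (Fin d)) ∈ interior Q ∩ latticePoints d := by
      rw [hQint]; rfl
    exact h.1
  have hint : interior Q = (fun x => x + latticePt w) '' interior ((r : ℝ) • P) := by
    rw [hQ]
    exact ((Homeomorph.addRight (latticePt w)).image_interior _).symm
  rw [hint] at h0
  obtain ⟨x, hx, hxw⟩ := h0
  have hxneg : x = -latticePt w := eq_neg_of_add_eq_zero_left hxw
  have hxlat : x ∈ latticePoints d := ⟨-w, by rw [hxneg]; ext j; simp [latticePt]⟩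
  have hxt : x = t := by
    have h : x ∈ interior ((r : ℝ) • P) ∩ latticePoints d := ⟨hx, hxlat⟩
    rw [ht] at h
    exact h
  rw [hQ] at hQdual
  convert hQdual using 3
  ext1 z
  rw [← hxt, hxneg, sub_neg_eq_add]

lemma image_sub_smul_simplex {d : ℕ} (v : Fin (d + 1) → Fin d → ℤ) (r : ℝ) (τ : Fin d → ℝ) :
    (fun x => x - WithLp.toLp 2 τ) '' (r • simplex v) =
      convexHull ℝ (Set.range fun k => (WithLp.toLp 2 (r • (fun j => (v k j : ℝ)) - τ) :
        EuclideanSpace ℝ (Fin d))) := by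
  let f : EuclideanSpace ℝ (Fin d) →ᵃ[ℝ] EuclideanSpace ℝ (Fin d) :=
    (r • LinearMap.id : EuclideanSpace ℝ (Fin d) →ₗ[ℝ] _).toAffineMap -
      AffineMap.const ℝ _ (WithLp.toLp 2 τ)
  have hf : ∀ x, f x = r • x - WithLp.toLp 2 τ := fun x => rfl
  have h := f.image_convexHull (Set.range fun i => latticePt (v i))
  rw [← Set.range_comp] at h
  rw [← Set.image_smul, Set.image_image]
  exact h

/-- The `i`-th barycentric coordinate expressed through the `i`-th dual vertex `y` and any
vertex `w_{k₀}` of the opposite facet. -/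
lemma coord_eq_mul_of_pairing {d : ℕ} {ι : Type*} [Fintype ι] [DecidableEq ι] {w : ι → Fin d → ℝ}
    {b : ι → ℝ} {r : ℝ} (hr : r ≠ 0) {τ y z : Fin d → ℝ} {i k₀ : ι} (hk₀ : k₀ ≠ i)
    (hb : b i ≠ 0)
    (hy : ∀ k, (r • w k - τ) ⬝ᵥ y = 1 - if k = i then r / b i else 0)
    {L : ι → ℝ} {κ : ℝ} (hLκ : ∑ k, L k = κ) (hLz : ∑ k, L k • w k = z) :
    L i = b i * (κ * (w k₀ ⬝ᵥ y) - z ⬝ᵥ y) := by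
  have h1 : ∑ k, L k * ((r • w k - τ) ⬝ᵥ y) = κ - L i * (r / b i) := by
    simp [hy, mul_sub, Finset.sum_sub_distrib, hLκ]
  have h2 : ∑ k, L k * ((r • w k - τ) ⬝ᵥ y) = r * (z ⬝ᵥ y) - κ * (τ ⬝ᵥ y) := by
    rw [← hLz, ← hLκ, sum_dotProduct, Finset.mul_sum, Finset.sum_mul, ← Finset.sum_sub_distrib]
    refine Finset.sum_congr rfl fun k _ => ?_
    rw [sub_dotProduct, smul_dotProduct, smul_dotProduct, smul_eq_mul, smul_eq_mul]
    ring
  have h3 := hy k₀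
  rw [if_neg hk₀, sub_dotProduct, smul_dotProduct, smul_eq_mul, sub_zero] at h3
  have h5 : L i * (r / b i) = r * (κ * (w k₀ ⬝ᵥ y) - z ⬝ᵥ y) := by
    linear_combination h1 - h2 - κ * h3
  field_simp at h5
  exact h5

/-- The coordinates of the interior lattice point of `rΔ` are reciprocals of integers `m_i > 1`, the
`i`-th coordinate of every element of `Λ_Δ` is killed by `m_i`, and the product of the `m_i`
determines the volume of the dual. -/
lemma exists_weights {d r : ℕ} (hd : 0 < d) {v : Fin (d + 1) → Fin d → ℤ}
    (hv : IsLatticeSimplex v) (hdet : (homMatrix v).det ≠ 0)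
    (hG : IsGorenstein r (simplex v)) (hpyr : ¬ IsLatticePyramid (simplex v))
    {t : EuclideanSpace ℝ (Fin d)}
    (ht : interior ((r : ℝ) • simplex v) ∩ latticePoints d = {t}) :
    ∃ m : Fin (d + 1) → ℕ, (∀ i, 1 < m i) ∧ ∑ i, (1 / (m i : ℝ)) = r ∧
      (∀ l ∈ Lam v, ∀ i, m i • l i = 0) ∧
      (fun i => ((1 / (m i : ℝ) : ℝ) : UnitAddCircle)) ∈ Lam v ∧
      normalizedVolume (polarDual ((fun x => x - t) '' ((r : ℝ) • simplex v))) =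
        r * (∏ i, (m i : ℝ)) / normalizedVolume (simplex v) := by
  have hr : (0 : ℝ) < r := Nat.cast_pos.2 hG.1
  have hdual := isLatticePolytope_polarDual hG ht
  have ht' : t ∈ interior ((r : ℝ) • simplex v) ∩ latticePoints d := by rw [ht]; rfl
  obtain ⟨b, hb, hbsum, hbt⟩ := exists_pos_coords_of_mem_interior hv hr ht'.1
  obtain ⟨T, hT⟩ := ht'.2
  set w : Fin (d + 1) → Fin d → ℝ := fun k j => (v k j : ℝ) with hwdef
  set τ : Fin d → ℝ := fun j => (T j : ℝ) with hτdef
  have hwdet : (homMatrix w).det ≠ 0 := by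
    rw [hwdef, det_homMatrix_intCast]; exact Int.cast_ne_zero.2 hdet
  have hbτ : ∑ i, b i • w i = τ := by
    have h := hbt.trans hT.symm
    ext j
    have h' := congrArg (fun x : EuclideanSpace ℝ (Fin d) => x j) h
    simpa [latticePt] using h'
  have htτ : t = WithLp.toLp 2 τ := hT.symm
  rw [htτ, image_sub_smul_simplex] at hdual ⊢
  change IsLatticePolytope (polarDual (convexHull ℝ (Set.range fun k =>
    (WithLp.toLp 2 ((r : ℝ) • w k - τ) : EuclideanSpace ℝ (Fin d))))) at hdual
  change ∃ m : Fin (d + 1) → ℕ, (∀ i, 1 < m i) ∧ ∑ i, (1 / (m i : ℝ)) = r ∧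
      (∀ l ∈ Lam v, ∀ i, m i • l i = 0) ∧ _ ∧
      normalizedVolume (polarDual (convexHull ℝ (Set.range fun k =>
    (WithLp.toLp 2 ((r : ℝ) • w k - τ) : EuclideanSpace ℝ (Fin d))))) = _
  have hpair := dotProduct_dualVertex (τ := τ) hwdet hb hbsum hbτ
  have hy : ∀ k i, inner ℝ (WithLp.toLp 2 ((r : ℝ) • w k - τ) : EuclideanSpace ℝ (Fin d))
      (WithLp.toLp 2 (dualVertex w b i)) = 1 - if k = i then (r : ℝ) / b i else 0 :=
    fun k i => by rw [inner_toLp, hpair]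
  have hbW : ∑ i, b i • (WithLp.toLp 2 ((r : ℝ) • w i - τ) : EuclideanSpace ℝ (Fin d)) = 0 := by
    ext j
    have h := congrFun hbτ j
    simp only [Finset.sum_apply, Pi.smul_apply, smul_eq_mul] at h
    simp only [WithLp.ofLp_sum, WithLp.ofLp_smul, Finset.sum_apply, Pi.smul_apply, Pi.sub_apply,
      smul_eq_mul, mul_sub, Finset.sum_sub_distrib, ← Finset.sum_mul, hbsum, PiLp.zero_apply]
    rw [← h, Finset.mul_sum, sub_eq_zero]
    exact Finset.sum_congr rfl fun k _ => by ring
  have hWdet : (homMatrix fun k => (r : ℝ) • w k - τ).det ≠ 0 := by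
    rw [det_homMatrix_smul_sub]
    exact mul_ne_zero (pow_ne_zero _ hr.ne') hwdet
  have hspan : ∀ x : EuclideanSpace ℝ (Fin d), (∀ k, inner ℝ
      (WithLp.toLp 2 ((r : ℝ) • w k - τ) : EuclideanSpace ℝ (Fin d)) x = 0) → x = 0 := by
    intro x hx
    have h := eq_zero_of_forall_dotProduct_eq_zero hWdet x.ofLp fun k => by
      rw [← inner_toLp]; exact hx k
    ext j
    exact congrFun h j
  have hdual_eq := polarDual_eq_convexHull hb hr hbsum hbW hspan hy
  -- The vertices of the dual are lattice points.
  have hlat : ∀ i, ∃ n : Fin d → ℤ, dualVertex w b i = fun j => (n j : ℝ) := by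
    intro i
    have hext := mem_extremePoints_polarDual hb hr hbW hspan hy i
    obtain ⟨S, hS⟩ := hdual
    rw [hS] at hext
    obtain ⟨n, -, hn⟩ := extremePoints_convexHull_subset hext
    exact ⟨n, (congrArg WithLp.ofLp hn).symm⟩
  choose n hn using hlat
  have hnt : Nontrivial (Fin (d + 1)) := Fin.nontrivial_iff_two_le.2 (by omega)
  -- `κ₀ i` is a vertex of the facet opposite to the `i`-th vertex.
  choose κ₀ hκ₀ using fun i : Fin (d + 1) => exists_ne i
  have hcoord : ∀ (i : Fin (d + 1)) (L : Fin (d + 1) → ℝ) (κ : ℝ) (z : Fin d → ℝ),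
      ∑ k, L k = κ → ∑ k, L k • w k = z →
      L i = b i * (κ * (w (κ₀ i) ⬝ᵥ fun j => (n i j : ℝ)) - z ⬝ᵥ fun j => (n i j : ℝ)) := by
    intro i L κ z h1 h2
    rw [← hn i]
    exact coord_eq_mul_of_pairing hr.ne' (hκ₀ i) (hb i).ne' (fun k => hpair k i) h1 h2
  have hcast : ∀ x y : Fin d → ℤ, ((fun j => (x j : ℝ)) ⬝ᵥ fun j => (y j : ℝ)) =
      ((x ⬝ᵥ y : ℤ) : ℝ) := fun x y => by simp [dotProduct]
  -- Specialize to the vertex `v_k`, whose coordinates are the `k`-th unit vector.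
  have hδ : ∀ i k, (if k = i then (1 : ℝ) else 0) =
      b i * (((-n i) ⬝ᵥ (v k - v (κ₀ i)) : ℤ) : ℝ) := by
    intro i k
    have h := hcoord i (Pi.single k 1) 1 (w k) (by simp) (by simp [Pi.single_apply])
    rw [hwdef, hcast, hcast, Pi.single_apply] at h
    rw [neg_dotProduct, dotProduct_sub, dotProduct_comm (n i), dotProduct_comm (n i)]
    push_cast
    simp only [eq_comm (a := i)] at h
    rw [h]
    ring
  set N : Fin (d + 1) → ℤ := fun i => (-n i) ⬝ᵥ (v i - v (κ₀ i)) with hN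
  have hbN : ∀ i, b i * (N i : ℝ) = 1 := fun i => by rw [← hδ i i, if_pos rfl]
  have hNpos : ∀ i, 0 < N i := fun i => by
    have : (0 : ℝ) < N i := pos_of_mul_pos_right (by rw [hbN]; exact one_pos) (hb i).le
    exact_mod_cast this
  have hm : ∀ i, (((N i).toNat : ℕ) : ℝ) = N i := fun i => by
    have := Int.toNat_of_nonneg (hNpos i).le
    exact_mod_cast this
  have hbm : ∀ i, 1 / (((N i).toNat : ℕ) : ℝ) = b i := fun i => by
    rw [hm]
    exact (eq_one_div_of_mul_eq_one_left (hbN i)).symm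
  refine ⟨fun i => (N i).toNat, fun i => ?_, ?_, ?_, ?_, ?_⟩
  · have h1 : N i ≠ 1 := by
      intro h1
      have hbi : b i = 1 := by simpa [h1] using hbN i
      refine hpyr (isLatticePyramid_of_functional hv (hκ₀ i) (-n i) (fun k hk => ?_) h1)
      have := hδ i k
      rw [if_neg hk, hbi, one_mul] at this
      exact_mod_cast this.symm
    have := hNpos i
    dsimp only
    omega
  · simp only [hbm, hbsum]
  · intro l hl i
    obtain ⟨L, rfl⟩ : ∃ L : Fin (d + 1) → ℝ, l = fun i => (L i : UnitAddCircle) :=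
      ⟨fun i => (l i).out, funext fun i => (Quotient.out_eq _).symm⟩
    rw [Lam_eq_torusKernel, coe_mem_torusKernel_iff, homMatrix_map_intCast] at hl
    obtain ⟨z, hz⟩ := hl
    have h1 : ∑ k, L k = z 0 := by simpa [Matrix.vecMul, dotProduct] using congrFun hz 0
    have h2 : ∑ k, L k • w k = fun j => ((fun j => z (Fin.succ j)) j : ℝ) := by
      ext j
      simpa [Matrix.vecMul, dotProduct, hwdef] using congrFun hz j.succ
    have h3 := hcoord i L _ _ h1 h2
    rw [hwdef, hcast, hcast] at h3
    dsimp only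
    rw [← AddCircle.coe_nsmul, AddCircle.coe_eq_zero_iff]
    refine ⟨z 0 * (v (κ₀ i) ⬝ᵥ n i) - (fun j => z (Fin.succ j)) ⬝ᵥ n i, ?_⟩
    rw [nsmul_eq_mul, hm, h3, ← mul_assoc, mul_comm (N i : ℝ), hbN]
    simp
  · simp only [hbm]
    rw [Lam_eq_torusKernel, coe_mem_torusKernel_iff, homMatrix_map_intCast]
    refine ⟨Fin.cons r T, funext fun j => ?_⟩
    refine Fin.cases ?_ (fun j => ?_) j
    · simpa [Matrix.vecMul, dotProduct] using hbsum
    · simpa [Matrix.vecMul, dotProduct, hwdef, hτdef] using congrFun hbτ j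
  · rw [hdual_eq, normalizedVolume_convexHull,
      abs_det_homMatrix_dualVertex hwdet hb hr hbsum hbτ, normalizedVolume_simplex,
      Nat.cast_natAbs, Int.cast_abs, ← det_homMatrix_intCast]
    have hprod : (∏ i, b i) * ∏ i, (((N i).toNat : ℕ) : ℝ) = 1 := by
      rw [← Finset.prod_mul_distrib]
      exact Finset.prod_eq_one fun i _ => by rw [hm, hbN]
    have hb0 := Finset.prod_ne_zero_iff.2 fun i (_ : i ∈ Finset.univ) => (hb i).ne'
    have hw0 := abs_ne_zero.2 hwdet
    rw [div_eq_div_iff (mul_ne_zero hb0 hw0) hw0]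
    linear_combination (-(r : ℝ) * |(homMatrix w).det|) * hprod


/-! ### Ordering the vertices by their weights -/

lemma zmultiples_eq_imp_addOrderOf_eq {ι G : Type*} [AddGroup G] {x y : ι → G}
    (h : AddSubgroup.zmultiples x = AddSubgroup.zmultiples y) (i : ι) :
    addOrderOf (x i) = addOrderOf (y i) := by
  have h1 := congrArg (AddSubgroup.map (Pi.evalAddMonoidHom (fun _ => G) i)) h
  rw [AddMonoidHom.map_zmultiples, AddMonoidHom.map_zmultiples] at h1
  rw [← Nat.card_zmultiples, ← Nat.card_zmultiples]
  exact congrArg (fun K : AddSubgroup G => Nat.card K) h1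

lemma comp_mem_Lam_iff {d : ℕ} (v : Fin (d + 1) → Fin d → ℤ) (σ : Equiv.Perm (Fin (d + 1)))
    (l : Fin (d + 1) → UnitAddCircle) : l ∘ σ ∈ Lam (v ∘ σ) ↔ l ∈ Lam v := by
  change ((∀ j, ∑ i, v (σ i) j • l (σ i) = 0) ∧ ∑ i, l (σ i) = 0) ↔
    ((∀ j, ∑ i, v i j • l i = 0) ∧ ∑ i, l i = 0)
  rw [Equiv.sum_comp σ l]
  simp only [fun j => Equiv.sum_comp σ fun i => v i j • l i]

lemma Lam_comp_eq_zmultiples {d : ℕ} {v : Fin (d + 1) → Fin d → ℤ}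
    {β : Fin (d + 1) → UnitAddCircle} (h : Lam v = AddSubgroup.zmultiples β)
    (σ : Equiv.Perm (Fin (d + 1))) : Lam (v ∘ σ) = AddSubgroup.zmultiples (β ∘ σ) := by
  ext l
  obtain ⟨l, rfl⟩ : ∃ l', l = l' ∘ σ := ⟨l ∘ σ.symm, by ext; simp⟩
  rw [comp_mem_Lam_iff, h, AddSubgroup.mem_zmultiples_iff, AddSubgroup.mem_zmultiples_iff]
  refine exists_congr fun k => ?_
  rw [← σ.surjective.injective_comp_right.eq_iff]
  rfl

lemma exists_perm_comp_eq {ι κ : Type*} [Fintype ι] [DecidableEq κ] {f g : ι → κ}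
    (h : Finset.univ.val.map f = Finset.univ.val.map g) : ∃ σ : Equiv.Perm ι, f ∘ σ = g := by
  have hcard : ∀ c, Nonempty ({i // g i = c} ≃ {i // f i = c}) := fun c => by
    have h1 := congrArg (Multiset.count c) h
    rw [Multiset.count_map, Multiset.count_map] at h1
    refine ⟨Fintype.equivOfCardEq ?_⟩
    rw [Fintype.card_subtype, Fintype.card_subtype]
    simp only [eq_comm (a := c)] at h1
    exact h1.symm
  let e := fun c => (hcard c).some
  exact ⟨Equiv.ofFiberEquiv e, funext fun i => Equiv.ofFiberEquiv_map e i⟩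

/-- The function on `Fin n` with `s₁` values `p`, then `s₂` values `q`, and `pq` afterwards: the
denominators of `weightVec`. -/
def blockDenominators (n p q s₁ s₂ : ℕ) : Fin n → ℕ := fun i =>
  if i.val < s₁ then p else if i.val < s₁ + s₂ then q else p * q

lemma weightVec_eq (d p q s₁ s₂ : ℕ) : weightVec d p q s₁ s₂ =
    fun i => ((1 / (blockDenominators (d + 1) p q s₁ s₂ i : ℝ) : ℝ) : UnitAddCircle) := by
  ext i
  simp only [weightVec, blockDenominators]
  split_ifs <;> simp

lemma map_blockDenominators {n p q s₁ s₂ s₃ : ℕ} (h : s₁ + s₂ + s₃ = n) :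
    Finset.univ.val.map (blockDenominators n p q s₁ s₂) =
      s₁ • {p} + s₂ • {q} + s₃ • {p * q} := by
  subst h
  rw [← Multiset.sum_map_singleton (Multiset.map _ _), Multiset.map_map]
  change ∑ i : Fin (s₁ + s₂ + s₃), ({blockDenominators (s₁ + s₂ + s₃) p q s₁ s₂ i} : Multiset ℕ) = _
  have h : ∀ x : ℕ, ¬ s₁ + s₂ + x < s₁ := fun x => by omega
  rw [Fin.sum_univ_add, Fin.sum_univ_add]
  simp [blockDenominators, h]

lemma map_eq_of_forall_mem {n p q : ℕ} (hp : p.Prime) (hq : q.Prime) (hpq : p ≠ q)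
    {m : Fin n → ℕ} (hm : ∀ i, m i = p ∨ m i = q ∨ m i = p * q) :
    ∃ s₁ s₂ s₃ : ℕ, s₁ + s₂ + s₃ = n ∧
      Finset.univ.val.map m = s₁ • {p} + s₂ • {q} + s₃ • {p * q} := by
  set S := Finset.univ.val.map m with hS
  have h1 : p ≠ p * q := fun h =>
    hq.one_lt.ne' (Nat.eq_of_mul_eq_mul_left hp.pos (by simpa using h.symm))
  have h2 : q ≠ p * q := fun h =>
    hp.one_lt.ne' (Nat.eq_of_mul_eq_mul_right hq.pos (by simpa using h.symm))
  have hmap : S = S.count p • {p} + S.count q • {q} + S.count (p * q) • {p * q} := by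
    ext x
    simp only [Multiset.count_add, Multiset.count_nsmul, Multiset.count_singleton]
    by_cases hx1 : x = p
    · subst hx1; simp [hpq, h1]
    by_cases hx2 : x = q
    · subst hx2; simp [hpq.symm, h2]
    by_cases hx3 : x = p * q
    · subst hx3; simp [h1.symm, h2.symm]
    simp only [hx1, hx2, hx3, if_false, mul_zero, add_zero, Multiset.count_eq_zero]
    intro hx
    obtain ⟨i, -, rfl⟩ := Multiset.mem_map.1 hx
    rcases hm i with h | h | h
    exacts [hx1 h, hx2 h, hx3 h]
  refine ⟨_, _, _, ?_, hmap⟩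
  have := congrArg Multiset.card hmap
  simpa [hS] using this.symm

lemma eq_of_dvd_mul_of_prime {p q x : ℕ} (hp : p.Prime) (hq : q.Prime) (hx : x ∣ p * q)
    (h1 : 1 < x) : x = p ∨ x = q ∨ x = p * q := by
  obtain ⟨a, b, ha, hb, rfl⟩ := (Nat.dvd_mul).1 hx
  rcases (Nat.dvd_prime hp).1 ha with rfl | rfl <;> rcases (Nat.dvd_prime hq).1 hb with rfl | rfl <;>
    simp_all

end GorensteinSimplex

theorem theorem4p5 (p q : ℕ) (hp : p.Prime) (hq : q.Prime) (hpq : p ≠ q) (d r : ℕ)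
    (v : Fin (d + 1) → Fin d → ℤ)
    (hv : GorensteinSimplex.IsLatticeSimplex v)
    (hvol : GorensteinSimplex.normalizedVolume (GorensteinSimplex.simplex v) = (p : ℝ) * (q : ℝ))
    (hG : GorensteinSimplex.IsGorenstein r (GorensteinSimplex.simplex v))
    (hpyr : ¬ GorensteinSimplex.IsLatticePyramid (GorensteinSimplex.simplex v))
    (t : EuclideanSpace ℝ (Fin d))
    (ht : interior ((r : ℝ) • GorensteinSimplex.simplex v) ∩
      GorensteinSimplex.latticePoints d = {t}) :
    (∃ s₁ s₂ s₃ : ℕ, GorensteinSimplex.HasType p q r v s₁ s₂ s₃) ∧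
    ∀ s₁ s₂ s₃ : ℕ, GorensteinSimplex.HasType p q r v s₁ s₂ s₃ →
      GorensteinSimplex.normalizedVolume (GorensteinSimplex.polarDual
          ((fun x => x - t) '' ((r : ℝ) • GorensteinSimplex.simplex v))) =
        (r : ℝ) * (p : ℝ) ^ ((s₁ : ℤ) + (s₃ : ℤ) - 1) * (q : ℝ) ^ ((s₂ : ℤ) + (s₃ : ℤ) - 1) := by
  open GorensteinSimplex in
  have hdet : (homMatrix v).det.natAbs = p * q := by
    rw [normalizedVolume_simplex] at hvol
    exact_mod_cast hvol
  have hp0 : (p : ℝ) ≠ 0 := Nat.cast_ne_zero.2 hp.ne_zero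
  have hq0 : (q : ℝ) ≠ 0 := Nat.cast_ne_zero.2 hq.ne_zero
  have hpq1 : 1 < p * q := Nat.one_lt_mul_iff.2 ⟨hp.pos, hq.pos, Or.inl hp.one_lt⟩
  have hdet0 : (homMatrix v).det ≠ 0 := by
    rw [← Int.natAbs_ne_zero, hdet]; omega
  -- A point has normalized volume `1`.
  have hd : 0 < d := by
    rcases Nat.eq_zero_or_pos d with rfl | h
    · rw [det_homMatrix, Matrix.det_isEmpty] at hdet
      simp at hdet
      omega
    · exact h
  obtain ⟨m, hm1, hmsum, hkill, hmem, hvoldual⟩ := exists_weights hd hv hdet0 hG hpyr ht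
  have hcard : Nat.card (Lam v) = p * q := by
    rw [Lam_eq_torusKernel, natCard_torusKernel _ hdet0, hdet]
  obtain ⟨hgen, hdvd⟩ := eq_zmultiples_of_forall_nsmul hp hq hpq (Lam v) hcard m
    (fun i => zero_lt_one.trans (hm1 i)) hkill hmem
  constructor
  · obtain ⟨s₁, s₂, s₃, hs, hmap⟩ := map_eq_of_forall_mem hp hq hpq
      fun i => eq_of_dvd_mul_of_prime hp hq (hdvd i) (hm1 i)
    refine ⟨s₁, s₂, s₃, hs, ?_, ?_⟩
    · have h := congrArg (fun S : Multiset ℕ => (S.map fun x : ℕ => 1 / (x : ℝ)).sum) hmap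
      simp only [Multiset.map_map, Multiset.map_add, Multiset.sum_add, Multiset.map_nsmul,
        Multiset.sum_nsmul, Multiset.map_singleton, Multiset.sum_singleton, nsmul_eq_mul] at h
      replace h := hmsum.symm.trans h
      push_cast at h
      field_simp at h
      have h' : (r : ℝ) * p * q = s₁ * q + s₂ * p + s₃ := by linarith
      exact_mod_cast h'
    · obtain ⟨σ, hσ⟩ := exists_perm_comp_eq (hmap.trans (map_blockDenominators hs).symm)
      refine ⟨σ, ?_⟩
      rw [Lam_comp_eq_zmultiples hgen, weightVec_eq, ← hσ]
      rfl
  · rintro s₁ s₂ s₃ ⟨hs, -, σ, hσ⟩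
    rw [Lam_comp_eq_zmultiples hgen, weightVec_eq] at hσ
    have hpos : ∀ i, 0 < blockDenominators (d + 1) p q s₁ s₂ i := fun i => by
      simp only [blockDenominators]
      split_ifs
      exacts [hp.pos, hq.pos, by omega]
    -- The entries of a generator are determined up to order by their additive orders.
    have hmσ : m ∘ σ = blockDenominators (d + 1) p q s₁ s₂ := by
      ext i
      have h := zmultiples_eq_imp_addOrderOf_eq hσ i
      dsimp only [Function.comp_apply] at h
      rw [AddCircle.addOrderOf_period_div (zero_lt_one.trans (hm1 _)),
        AddCircle.addOrderOf_period_div (hpos i)] at h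
      exact h
    have hprod : ∏ i, (m i : ℝ) = p ^ s₁ * q ^ s₂ * (p * q) ^ s₃ := by
      have h := congrArg Multiset.prod (map_blockDenominators (p := p) (q := q) hs)
      rw [← hmσ] at h
      simp only [Multiset.prod_add, Multiset.prod_nsmul, Multiset.prod_singleton] at h
      have h2 : ∏ i, m i = p ^ s₁ * q ^ s₂ * (p * q) ^ s₃ := by
        rw [← Equiv.prod_comp σ m]; exact h
      exact_mod_cast h2
    rw [hvoldual, hvol, hprod, zpow_sub_one₀ hp0, zpow_sub_one₀ hq0, zpow_add₀ hp0, zpow_add₀ hq0]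
    simp only [zpow_natCast]
    field_simp
    rw [mul_pow, mul_assoc]
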